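/- Let $d\ge 1$, $\lambda=(\lambda_1,\dots,\lambda_d)\ne 0$, $p(x)=\sum_{i=1}^d\lambda_i x^i$ and $|\lambda|=\sum_{i=1}^d|\lambda_i|$. For real $\lambda$ let $X$ be the Liénard vector field $$\dot x=y,\qquad \dot y=-x+p(x)\,y .$$ Its return mapping sends $r>0$ to the number $s>0$ such that the trajectory of $X$ starting at $(r,0)$ meets the positive $x$-axis again for the first time at $(s,0)$. In polar coordinates $x=r\cos\theta$, $y=r\sin\theta$ (the angle decreases along small trajectories) the trajectories satisfy $$\frac{dr}{d\theta}=\frac{r\,p(r\cos\theta)\sin^2\theta}{-1+\sin\theta\cos\theta\,p(r\cos\theta)},\qquad(*)$$ and for $\lambda\in\mathbb C^d$ and complex $r$ the return mapping is the mapping $r(2\pi)\mapsto r(0)$ along solutions $r:[0,2\pi]\to\mathbb C$ of $(*)$ whose denominator does not vanish. For every $\lambda\in\mathbb C^d\setminus\{0\}$ there is a unique $\rho>0$ with $$\rho^d|\lambda_d|+\dots+\rho|\lambda_1|=1,$$ and the return mapping converges at least on the disc $D(0,\rho/2)$: there is a power series $\sum_k a_kz^k$ which converges for all complex $z$ with $|z|<\rho/2$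 and whose sum there is the image of $z$ under the return mapping (in particular the solution of $(*)$ with $r(2\pi)=z$ exists on $[0,2\pi]$). If $\lambda$ is real and $0<r<\rho/2$, the sum at $r$ is the value at $r$ of the return mapping of $X$. The same holds, on the same disc, for the inverse of the return mapping. Moreover $\rho/2$ improves the bound $1/(1+|\lambda|)$ for small $|\lambda|$, but not in general for large $|\lambda|$: there is $\varepsilon>0$, depending only on $d$, such that $\rho/2>1/(1+|\lambda|)$ whenever $0<|\lambda|<\varepsilon$, while for every $M$ there is a real $\lambda$ with $|\lambda|>M$ and $\rho/2<1/(1+|\lambda|)$. -/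

import Mathlib

noncomputable section

/-- `p(x) = ∑_{i=1}^d λ_i x^i`; the coefficient `λ_i` is `lam (i - 1)`. -/
def lienardPoly {K : Type*} [CommSemiring K] {d : ℕ} (lam : Fin d → K) (x : K) : K :=
  ∑ i : Fin d, lam i * x ^ (i.val + 1)

/-- The Liénard vector field `X = y ∂/∂x + (-x + p(x) y) ∂/∂y`, that is
the system `dx/dt = y`, `dy/dt = -x + p(x) y`. -/
def lienardField {d : ℕ} (lam : Fin d → ℝ) (q : ℝ × ℝ) : ℝ × ℝ :=
  (q.2, -q.1 + lienardPoly lam q.1 * q.2)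

/-- The real return mapping of the field on the positive `x`-axis, as a relation: the
trajectory which starts at `(r, 0)`, `r > 0`, meets the positive `x`-axis again for the first
(positive) time at `(s, 0)`. -/
def IsFirstReturn {d : ℕ} (lam : Fin d → ℝ) (r s : ℝ) : Prop :=
  0 < r ∧ 0 < s ∧ ∃ T : ℝ, 0 < T ∧ ∃ γ : ℝ → ℝ × ℝ,
    (∀ t ∈ Set.Icc 0 T, HasDerivWithinAt γ (lienardField lam (γ t)) (Set.Icc 0 T) t) ∧
    γ 0 = (r, 0) ∧ γ T = (s, 0) ∧
    ∀ t ∈ Set.Ioo 0 T, ¬ (0 < (γ t).1 ∧ (γ t).2 = 0)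

/-- The factor `-1 + sin θ cos θ p(r cos θ)`, the angular velocity of the field in polar
coordinates. -/
def polarAngular {d : ℕ} (lam : Fin d → ℂ) (θ : ℝ) (r : ℂ) : ℂ :=
  -1 + (Real.sin θ : ℂ) * (Real.cos θ : ℂ) * lienardPoly lam (r * (Real.cos θ : ℂ))

/-- Right-hand side of the polar equation
`dr/dθ = r p(r cos θ) sin² θ / (-1 + sin θ cos θ p(r cos θ))`. -/
def polarSlope {d : ℕ} (lam : Fin d → ℂ) (θ : ℝ) (r : ℂ) : ℂ :=
  r * lienardPoly lam (r * (Real.cos θ : ℂ)) * (Real.sin θ : ℂ) ^ 2 / polarAngular lam θ r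

/-- The complexified return mapping, as a relation: the solution of the polar equation with
value `z` at `θ = 2π` exists down to `θ = 0` and has the value `w` there.  (The field turns
clockwise, so the angle decreases as time increases.) -/
def IsReturn {d : ℕ} (lam : Fin d → ℂ) (z w : ℂ) : Prop :=
  ∃ r : ℝ → ℂ, r (2 * Real.pi) = z ∧ r 0 = w ∧
    ∀ θ ∈ Set.Icc 0 (2 * Real.pi), polarAngular lam θ (r θ) ≠ 0 ∧
      HasDerivWithinAt r (polarSlope lam θ (r θ)) (Set.Icc 0 (2 * Real.pi)) θ

/-- `ρ` is a positive solution of `ρ^d |λ_d| + ⋯ + ρ |λ_1| = 1`. -/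
def IsScale {d : ℕ} (lam : Fin d → ℂ) (ρ : ℝ) : Prop :=
  0 < ρ ∧ ∑ i : Fin d, ρ ^ (i.val + 1) * ‖lam i‖ = 1

end

/-!
The coefficients of `p(ρ x)` have moduli summing to `1`, so `|p(x)| ≤ |x| / ρ` for `|x| ≤ ρ`. Hence
on the disc of radius `ρ` the angular velocity stays away from `0`, and the polar equation is
regular there.

A solution starting at `θ = 2π` in the disc of radius `ρ / 2` does not leave the disc of radius `ρ`
before `θ = 0`. Indeed `1 / r - λ₁ sin³ θ / 3` varies slowly, since the second term absorbs the
part of first order in `p`; its square has derivative of modulus at most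
`2 (1 + α / 3) (9 / 5 - α) sin² θ cos² θ / ρ²`, where `α = ρ |λ₁| ≤ 1`; here `1 - α` comes from the
higher coefficients of `p`, and `4 / 5` bounds `|sin θ cos θ|` divided by the angular velocity. The
integral of `sin² θ cos² θ` over a turn is `π / 4`, so the modulus of the square stays above
`(1 + α / 3)² / ρ²` once it exceeds `4 / ρ²` at `θ = 2π`, which forces `|r| < ρ`.

The difference of two solutions solves a scalar linear equation, with coefficient the divided
difference of the slope, so it is the difference of the initial values times an exponential.
Letting the two solutions merge gives the complex derivative with respect to the initial value, so
the return mapping is holomorphic on the disc of radius `ρ / 2` and is the sum of its Taylor series.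
For real parameters, comparison with the conjugate solution shows that a solution with real initial
value is real, and comparison with the zero solution that it stays positive; run through with the
angular velocity it is a trajectory of the Liénard field. The inverse return mapping is the return
mapping for `-λ`, by the symmetry `θ ↦ 2π - θ`.
-/

open Set Filter Metric
open scoped Topology NNReal

section LinearEquation

theorem eq_mul_exp_integral_of_isIntegralCurveOn {a b : ℝ} {f A : ℝ → ℂ}
    (hA : ContinuousOn A (Icc a b)) (hf : IsIntegralCurveOn f (fun t x => A t * x) (Icc a b))
    {c t : ℝ} (hc : c ∈ Icc a b) (ht : t ∈ Icc a b) :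
    f t = f c * Complex.exp (∫ s in c..t, A s) := by
  have hab : a ≤ b := hc.1.trans hc.2
  set B : ℝ → ℂ := IccExtend hab ((Icc a b).domRestrict A)
  have hB_cont : Continuous B := (continuousOn_iff_continuous_domRestrict.1 hA).Icc_extend'
  have hBA : ∀ s ∈ Icc a b, B s = A s := fun s hs => IccExtend_of_mem hab _ hs
  set P : ℝ → ℂ := fun u => ∫ s in c..u, B s
  have hP_deriv : ∀ u, HasDerivAt P (B u) u := fun u =>
    (hB_cont.integral_hasStrictDerivAt c u).hasDerivAt
  have hconst : ∀ u ∈ Icc a b,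
      HasDerivWithinAt (fun u => f u * Complex.exp (-P u)) 0 (Icc a b) u := fun u hu => by
    refine ((hf u hu).mul (hP_deriv u).neg.cexp.hasDerivWithinAt).congr_deriv ?_
    rw [hBA u hu]
    ring
  have hPc : P c = 0 := intervalIntegral.integral_same
  have hPt : P t = ∫ s in c..t, A s :=
    intervalIntegral.integral_congr fun s hs => hBA s (uIcc_subset_Icc hc ht hs)
  have heq : f t * Complex.exp (-P t) = f c := by
    have := (convex_Icc a b).norm_image_sub_le_of_norm_hasDerivWithin_le (C := 0) hconst
      (fun _ _ => norm_zero.le) hc ht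
    simpa only [hPc, neg_zero, Complex.exp_zero, mul_one, zero_mul, norm_le_zero_iff, sub_eq_zero]
      using this
  rw [← heq, ← hPt, mul_assoc, ← Complex.exp_add, neg_add_cancel, Complex.exp_zero, mul_one]

end LinearEquation

section NormedSpace

variable {E : Type*} [NormedAddCommGroup E] [NormedSpace ℝ E]

theorem lt_of_forall_lt_of_continuousOn_Icc {g : ℝ → ℝ} {a b R : ℝ} (hg : ContinuousOn g (Icc a b))
    (hb : g b < R) (hstep : ∀ c ∈ Icc a b, (∀ t ∈ Icc c b, g t ≤ R) → g c < R) :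
    ∀ t ∈ Icc a b, g t < R := by
  have hcross : ∀ t ∈ Icc a b, R ≤ g t → ∃ c ∈ Icc t b, g c = R := fun t ht hle =>
    intermediate_value_Icc' ht.2 (hg.mono (Icc_subset_Icc_left ht.1)) ⟨hb.le, hle⟩
  by_contra! ⟨t, ht, hle⟩
  have hcompact : IsCompact (Icc a b ∩ g ⁻¹' {R}) :=
    isCompact_Icc.of_isClosed_subset
      (hg.preimage_isClosed_of_isClosed isClosed_Icc isClosed_singleton) inter_subset_left
  obtain ⟨c, hc, hcR⟩ := hcross t ht hle
  obtain ⟨c, ⟨hc, hcR⟩, hlast⟩ :=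
    hcompact.exists_isGreatest ⟨c, ⟨ht.1.trans hc.1, hc.2⟩, hcR⟩
  refine (hstep c hc fun s hs => ?_).ne hcR
  by_contra! hlt
  obtain ⟨e, he, heR⟩ := hcross s ⟨hc.1.trans hs.1, hs.2⟩ hlt.le
  have hsc : s = c :=
    le_antisymm (he.1.trans (hlast ⟨⟨hc.1.trans (hs.1.trans he.1), he.2⟩, heR⟩)) hs.1
  exact hlt.ne' (hsc ▸ hcR)

/-- The radial retraction of a normed space onto its closed ball of radius `R` around `0`. Composed
with it, a vector field that is Lipschitz on the ball becomes globally Lipschitz. -/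
noncomputable def radialRetraction (R : ℝ) (x : E) : E := (R / max R ‖x‖) • x

theorem radialRetraction_of_norm_le {R : ℝ} (hR : 0 < R) {x : E} (hx : ‖x‖ ≤ R) :
    radialRetraction R x = x := by
  rw [radialRetraction, max_eq_left hx, div_self hR.ne', one_smul]

theorem norm_radialRetraction_le {R : ℝ} (hR : 0 < R) (x : E) : ‖radialRetraction R x‖ ≤ R := by
  have hmax : 0 < max R ‖x‖ := lt_max_of_lt_left hR
  rw [radialRetraction, norm_smul, Real.norm_of_nonneg (by positivity), div_mul_eq_mul_div,
    div_le_iff₀ hmax]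
  gcongr
  exact le_max_right _ _

theorem lipschitzWith_radialRetraction {R : ℝ} (hR : 0 < R) :
    LipschitzWith 2 (radialRetraction R : E → E) := by
  refine LipschitzWith.of_dist_le_mul fun x y => ?_
  rw [dist_eq_norm, dist_eq_norm, NNReal.coe_ofNat]
  set m := max R ‖x‖ with hm
  set n := max R ‖y‖ with hn
  have hm0 : 0 < m := lt_max_of_lt_left hR
  have hn0 : 0 < n := lt_max_of_lt_left hR
  have hdiff : |n - m| ≤ ‖x - y‖ := by
    have := abs_max_sub_max_le_max R ‖y‖ R ‖x‖
    rw [sub_self, abs_zero, max_eq_right (abs_nonneg (‖y‖ - ‖x‖))] at this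
    exact this.trans (norm_sub_rev x y ▸ abs_norm_sub_norm_le y x)
  have hRm : R / m ≤ 1 := (div_le_one hm0).2 (le_max_left _ _)
  have hyn : ‖y‖ / n ≤ 1 := (div_le_one hn0).2 (le_max_right _ _)
  have hsplit : radialRetraction R x - radialRetraction R y =
      (R / m) • (x - y) + (R / m * ((n - m) / n)) • y := by
    have hcoeff : R / m * ((n - m) / n) = R / m - R / n := by field_simp
    rw [radialRetraction, radialRetraction, ← hm, ← hn, hcoeff, smul_sub, sub_smul]
    abel
  calc ‖radialRetraction R x - radialRetraction R y‖
      ≤ ‖(R / m) • (x - y)‖ + ‖(R / m * ((n - m) / n)) • y‖ := hsplit ▸ norm_add_le _ _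
    _ = R / m * ‖x - y‖ + R / m * (|n - m| * (‖y‖ / n)) := by
      rw [norm_smul, norm_smul, Real.norm_eq_abs, Real.norm_eq_abs, abs_mul, abs_div (n - m),
        abs_of_pos hn0, abs_of_pos (div_pos hR hm0)]
      ring
    _ ≤ 1 * ‖x - y‖ + 1 * (‖x - y‖ * 1) := by gcongr
    _ = 2 * ‖x - y‖ := by ring

/-- An integral curve of the time-dependent vector field `F` over `I` with values in `K`, where the
estimates for `F` hold. -/
structure IsConfinedIntegralCurve (F : ℝ → E → E) (I : Set ℝ) (K : Set E) (r : ℝ → E) :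
    Prop where
  isIntegralCurveOn : IsIntegralCurveOn r F I
  mapsTo : MapsTo r I K

theorem IsConfinedIntegralCurve.continuousOn {F : ℝ → E → E} {I : Set ℝ} {K : Set E} {r : ℝ → E}
    (hr : IsConfinedIntegralCurve F I K r) : ContinuousOn r I :=
  fun t ht => (hr.isIntegralCurveOn t ht).continuousWithinAt

variable [CompleteSpace E]

theorem exists_isIntegralCurveOn_comp_radialRetraction {F : ℝ → E → E} {a b R : ℝ} {L : ℝ≥0}
    (hR : 0 < R) (hLip : ∀ t ∈ Icc a b, LipschitzOnWith L (F t) (closedBall 0 R))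
    (hcont : ∀ x ∈ closedBall 0 R, ContinuousOn (F · x) (Icc a b)) (t₀ : Icc a b) (z : E) :
    ∃ r : ℝ → E, r t₀ = z ∧
      IsIntegralCurveOn r (fun t x => F t (radialRetraction R x)) (Icc a b) := by
  have hball : ∀ x : E, radialRetraction R x ∈ closedBall 0 R := fun x =>
    mem_closedBall_zero_iff.2 (norm_radialRetraction_le hR x)
  have hzero : (0 : E) ∈ closedBall 0 R := mem_closedBall_self hR.le
  obtain ⟨C, hC⟩ := isCompact_Icc.exists_bound_of_continuousOn (hcont 0 hzero)
  have hbound : ∀ t ∈ Icc a b, ∀ x ∈ closedBall 0 R, ‖F t x‖ ≤ (C + L * R).toNNReal :=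
    fun t ht x hx => by
      refine le_trans ?_ (Real.le_coe_toNNReal _)
      have hdist : ‖F t x - F t 0‖ ≤ L * ‖x - 0‖ := (hLip t ht).norm_sub_le hx hzero
      rw [sub_zero] at hdist
      calc ‖F t x‖ ≤ ‖F t 0‖ + ‖F t x - F t 0‖ := norm_le_insert' _ _
        _ ≤ C + L * R := by
          gcongr
          · exact hC t ht
          · exact hdist.trans (by gcongr; exact mem_closedBall_zero_iff.1 hx)
  have hPL : IsPicardLindelof (fun t x => F t (radialRetraction R x)) t₀ z
      ((C + L * R).toNNReal * (b - a).toNNReal) 0 (C + L * R).toNNReal (L * 2) :=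
    { lipschitzOnWith := fun t ht =>
        (hLip t ht).comp (lipschitzWith_radialRetraction hR).lipschitzOnWith fun x _ => hball x
      continuousOn := fun x _ => hcont _ (hball x)
      norm_le := fun t ht x _ => hbound t ht _ (hball x)
      mul_max_le := by
        rw [NNReal.coe_zero, sub_zero, NNReal.coe_mul]
        gcongr
        exact (max_le (sub_le_sub_left t₀.2.1 b) (sub_le_sub_right t₀.2.2 a)).trans
          (Real.le_coe_toNNReal _) }
  exact hPL.exists_eq_forall_mem_Icc_hasDerivWithinAt₀

theorem exists_isConfinedIntegralCurve_of_apriori_bound {F : ℝ → E → E} {a b R : ℝ} {L : ℝ≥0}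
    (hab : a ≤ b) (hLip : ∀ t ∈ Icc a b, LipschitzOnWith L (F t) (closedBall 0 R))
    (hcont : ∀ x ∈ closedBall 0 R, ContinuousOn (F · x) (Icc a b)) {z : E} (hz : ‖z‖ < R)
    (hbound : ∀ c ∈ Icc a b, ∀ r, IsConfinedIntegralCurve F (Icc c b) (closedBall 0 R) r →
      r b = z → ‖r c‖ < R) :
    ∃ r, IsConfinedIntegralCurve F (Icc a b) (closedBall 0 R) r ∧ r b = z := by
  have hR : 0 < R := (norm_nonneg z).trans_lt hz
  obtain ⟨r, hrb, hr⟩ := exists_isIntegralCurveOn_comp_radialRetraction hR hLip hcont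
    ⟨b, right_mem_Icc.2 hab⟩ z
  have hcurve : ∀ c ∈ Icc a b, (∀ t ∈ Icc c b, ‖r t‖ ≤ R) →
      IsConfinedIntegralCurve F (Icc c b) (closedBall 0 R) r := fun c hc hle =>
    { isIntegralCurveOn := fun t ht => by
        have hderiv := hr.mono (Icc_subset_Icc_left hc.1) t ht
        beta_reduce at hderiv
        rwa [radialRetraction_of_norm_le hR (hle t ht)] at hderiv
      mapsTo := fun t ht => mem_closedBall_zero_iff.2 (hle t ht) }
  have hlt : ∀ t ∈ Icc a b, ‖r t‖ < R := by
    refine lt_of_forall_lt_of_continuousOn_Icc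
      (fun t ht => (hr t ht).continuousWithinAt.norm) (hrb ▸ hz) fun c hc hle => ?_
    exact hbound c hc r (hcurve c hc hle) hrb
  exact ⟨r, hcurve a (left_mem_Icc.2 hab) fun t ht => (hlt t ht).le, hrb⟩

end NormedSpace

section DividedDifference

/-- `Q t x y` is a continuous divided difference of the time-dependent vector field `F t` between
the points `x` and `y` of `K`, at the times `t ∈ I`. It turns the difference of two integral curves
of `F` into a solution of a scalar linear equation. -/
structure IsDividedDifferenceOn (Q : ℝ → ℂ → ℂ → ℂ) (F : ℝ → ℂ → ℂ) (I : Set ℝ) (K : Set ℂ) :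
    Prop where
  sub_eq : ∀ t ∈ I, ∀ x ∈ K, ∀ y ∈ K, F t x - F t y = Q t x y * (x - y)
  continuousOn : ContinuousOn (fun q : ℝ × ℂ × ℂ => Q q.1 q.2.1 q.2.2) (I ×ˢ K ×ˢ K)

namespace IsDividedDifferenceOn

variable {Q : ℝ → ℂ → ℂ → ℂ} {F : ℝ → ℂ → ℂ} {I : Set ℝ} {K : Set ℂ}

theorem exists_norm_le (hQ : IsDividedDifferenceOn Q F I K) (hI : IsCompact I) (hK : IsCompact K) :
    ∃ M, 0 ≤ M ∧ ∀ t ∈ I, ∀ x ∈ K, ∀ y ∈ K, ‖Q t x y‖ ≤ M := by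
  obtain ⟨M, hM⟩ := (hI.prod (hK.prod hK)).exists_bound_of_continuousOn hQ.continuousOn
  exact ⟨max M 0, le_max_right _ _, fun t ht x hx y hy =>
    (hM (t, x, y) ⟨ht, hx, hy⟩).trans (le_max_left _ _)⟩

theorem exists_lipschitzOnWith (hQ : IsDividedDifferenceOn Q F I K) (hI : IsCompact I)
    (hK : IsCompact K) : ∃ L : ℝ≥0, ∀ t ∈ I, LipschitzOnWith L (F t) K := by
  obtain ⟨M, hM0, hM⟩ := hQ.exists_norm_le hI hK
  refine ⟨⟨M, hM0⟩, fun t ht => LipschitzOnWith.of_dist_le_mul fun x hx y hy => ?_⟩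
  rw [dist_eq_norm, dist_eq_norm, hQ.sub_eq t ht x hx y hy, norm_mul]
  exact mul_le_mul_of_nonneg_right (hM t ht x hx y hy) (norm_nonneg _)

theorem continuousOn_comp (hQ : IsDividedDifferenceOn Q F I K) {r q : ℝ → ℂ}
    (hr : IsConfinedIntegralCurve F I K r) (hq : IsConfinedIntegralCurve F I K q) :
    ContinuousOn (fun t => Q t (r t) (q t)) I :=
  hQ.continuousOn.comp (f := fun t => (t, r t, q t))
    (continuousOn_id.prodMk (hr.continuousOn.prodMk hq.continuousOn))
    fun _ ht => ⟨ht, hr.mapsTo ht, hq.mapsTo ht⟩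

section Interval

variable {a b c t : ℝ}

theorem sub_eq_mul_exp (hQ : IsDividedDifferenceOn Q F (Icc a b) K) {r q : ℝ → ℂ}
    (hr : IsConfinedIntegralCurve F (Icc a b) K r) (hq : IsConfinedIntegralCurve F (Icc a b) K q)
    (hc : c ∈ Icc a b) (ht : t ∈ Icc a b) :
    r t - q t = (r c - q c) * Complex.exp (∫ s in c..t, Q s (r s) (q s)) := by
  refine eq_mul_exp_integral_of_isIntegralCurveOn (f := fun t => r t - q t)
    (hQ.continuousOn_comp hr hq) (fun s hs => ?_) hc ht
  beta_reduce
  rw [← hQ.sub_eq s hs _ (hr.mapsTo hs) _ (hq.mapsTo hs)]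
  exact (hr.isIntegralCurveOn s hs).sub (hq.isIntegralCurveOn s hs)

theorem norm_sub_le (hQ : IsDividedDifferenceOn Q F (Icc a b) K) {M : ℝ}
    (hM : ∀ t ∈ Icc a b, ∀ x ∈ K, ∀ y ∈ K, ‖Q t x y‖ ≤ M) {r q : ℝ → ℂ}
    (hr : IsConfinedIntegralCurve F (Icc a b) K r) (hq : IsConfinedIntegralCurve F (Icc a b) K q)
    (hc : c ∈ Icc a b) (ht : t ∈ Icc a b) :
    ‖r t - q t‖ ≤ ‖r c - q c‖ * Real.exp (M * |t - c|) := by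
  rw [hQ.sub_eq_mul_exp hr hq hc ht, norm_mul]
  gcongr
  refine (Complex.norm_exp_le_exp_norm _).trans (Real.exp_le_exp.2 ?_)
  refine intervalIntegral.norm_integral_le_of_norm_le_const fun s hs => ?_
  have hs' := uIcc_subset_Icc hc ht (uIoc_subset_uIcc hs)
  exact hM s hs' _ (hr.mapsTo hs') _ (hq.mapsTo hs')

variable {U : Set ℂ} {r : ℂ → ℝ → ℂ} {z : ℂ}

theorem tendsto_of_initial_value (hQ : IsDividedDifferenceOn Q F (Icc a b) K) (hK : IsCompact K)
    (hc : c ∈ Icc a b) (hU : U ∈ 𝓝 z)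
    (hr : ∀ w ∈ U, IsConfinedIntegralCurve F (Icc a b) K (r w) ∧ r w c = w) (ht : t ∈ Icc a b) :
    Tendsto (fun w => r w t) (𝓝 z) (𝓝 (r z t)) := by
  obtain ⟨M, -, hM⟩ := hQ.exists_norm_le isCompact_Icc hK
  have hzU := mem_of_mem_nhds hU
  have hbound : Tendsto (fun w => ‖w - z‖ * Real.exp (M * |t - c|)) (𝓝 z) (𝓝 0) := by
    have hcont : Continuous fun w => ‖w - z‖ * Real.exp (M * |t - c|) := by fun_prop
    simpa only [sub_self, norm_zero, zero_mul] using hcont.tendsto z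
  rw [tendsto_iff_norm_sub_tendsto_zero]
  refine squeeze_zero' (Eventually.of_forall fun _ => norm_nonneg _) ?_ hbound
  filter_upwards [hU] with w hw
  simpa only [(hr w hw).2, (hr z hzU).2] using hQ.norm_sub_le hM (hr w hw).1 (hr z hzU).1 hc ht

theorem tendsto_integral_of_initial_value (hQ : IsDividedDifferenceOn Q F (Icc a b) K)
    (hK : IsCompact K) (hc : c ∈ Icc a b) (hU : U ∈ 𝓝 z)
    (hr : ∀ w ∈ U, IsConfinedIntegralCurve F (Icc a b) K (r w) ∧ r w c = w) (ht : t ∈ Icc a b) :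
    Tendsto (fun w => ∫ s in c..t, Q s (r w s) (r z s)) (𝓝 z)
      (𝓝 (∫ s in c..t, Q s (r z s) (r z s))) := by
  obtain ⟨M, -, hM⟩ := hQ.exists_norm_le isCompact_Icc hK
  have hz := (hr z (mem_of_mem_nhds hU)).1
  have hsub : uIoc c t ⊆ Icc a b := uIoc_subset_uIcc.trans (uIcc_subset_Icc hc ht)
  refine intervalIntegral.tendsto_integral_filter_of_dominated_convergence (fun _ => M) ?_ ?_
    intervalIntegrable_const (Eventually.of_forall fun s hs => ?_)
  · filter_upwards [hU] with w hw
    exact ((hQ.continuousOn_comp (hr w hw).1 hz).mono hsub).aestronglyMeasurable measurableSet_uIoc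
  · filter_upwards [hU] with w hw
    exact Eventually.of_forall fun s hs =>
      hM s (hsub hs) _ ((hr w hw).1.mapsTo (hsub hs)) _ (hz.mapsTo (hsub hs))
  · have hs' := hsub hs
    refine (hQ.continuousOn (s, r z s, r z s) ⟨hs', hz.mapsTo hs', hz.mapsTo hs'⟩).tendsto.comp
      (f := fun w => (s, r w s, r z s)) (tendsto_nhdsWithin_iff.2 ⟨?_, ?_⟩)
    · exact tendsto_const_nhds.prodMk_nhds
        ((hQ.tendsto_of_initial_value hK hc hU hr hs').prodMk_nhds tendsto_const_nhds)
    · filter_upwards [hU] with w hw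
      exact ⟨hs', (hr w hw).1.mapsTo hs', hz.mapsTo hs'⟩

theorem hasDerivAt_initial_value (hQ : IsDividedDifferenceOn Q F (Icc a b) K)
    (hK : IsCompact K) (hc : c ∈ Icc a b) (hU : U ∈ 𝓝 z)
    (hr : ∀ w ∈ U, IsConfinedIntegralCurve F (Icc a b) K (r w) ∧ r w c = w) (ht : t ∈ Icc a b) :
    HasDerivAt (fun w => r w t) (Complex.exp (∫ s in c..t, Q s (r z s) (r z s))) z := by
  have hzU := mem_of_mem_nhds hU
  rw [hasDerivAt_iff_tendsto_slope]
  refine Tendsto.congr' ?_ (((Complex.continuous_exp.tendsto _).comp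
    (hQ.tendsto_integral_of_initial_value hK hc hU hr ht)).mono_left nhdsWithin_le_nhds)
  filter_upwards [nhdsWithin_le_nhds hU, self_mem_nhdsWithin] with w hw hne
  rw [slope_def_field, hQ.sub_eq_mul_exp (hr w hw).1 (hr z hzU).1 hc ht, (hr w hw).2, (hr z hzU).2,
    mul_div_cancel_left₀ _ (sub_ne_zero.2 hne), Function.comp_apply]

end Interval

end IsDividedDifferenceOn

end DividedDifference

section Reparametrization

theorem exists_orderIso_hasDerivAt {g : ℝ → ℝ} (hg : Continuous g) {m : ℝ} (hm : 0 < m)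
    (hle : ∀ x, m ≤ g x) : ∃ e : ℝ ≃o ℝ, ∀ x, HasDerivAt e (g x) x := by
  set G : ℝ → ℝ := fun x => ∫ s in (0 : ℝ)..x, g s
  have hderiv : ∀ x, HasDerivAt G (g x) x := fun x => (hg.integral_hasStrictDerivAt 0 x).hasDerivAt
  have hdiff : Differentiable ℝ G := fun x => (hderiv x).differentiableAt
  have hG0 : G 0 = 0 := intervalIntegral.integral_same
  have hgrowth : ∀ ⦃x y⦄, x ≤ y → m * (y - x) ≤ G y - G x :=
    mul_sub_le_image_sub_of_le_deriv hdiff fun x => (hderiv x).deriv.symm ▸ hle x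
  have hmono : StrictMono G := strictMono_of_hasDerivAt_pos hderiv fun x => hm.trans_le (hle x)
  have hsurj : Function.Surjective G := by
    refine hdiff.continuous.surjective
      (tendsto_atTop_mono' _ ?_ (tendsto_id.const_mul_atTop hm))
      (tendsto_atBot_mono' _ ?_ (tendsto_id.const_mul_atBot hm))
    · filter_upwards [eventually_ge_atTop 0] with x hx
      simpa only [hG0, sub_zero, id] using hgrowth hx
    · filter_upwards [eventually_le_atBot 0] with x hx
      simpa only [hG0, zero_sub, mul_neg, neg_le_neg_iff, id] using hgrowth hx
  exact ⟨hmono.orderIsoOfSurjective G hsurj, hderiv⟩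

theorem exists_strictAnti_isIntegralCurveOn {ω : ℝ → ℝ} {a b : ℝ} (hab : a < b)
    (hω : ContinuousOn ω (Icc a b)) (hpos : ∀ θ ∈ Icc a b, 0 < ω θ) :
    ∃ T > 0, ∃ ϑ : ℝ → ℝ, StrictAnti ϑ ∧ ϑ 0 = b ∧ ϑ T = a ∧
      IsIntegralCurveOn ϑ (fun _ θ => -ω θ) (Icc 0 T) := by
  set W : ℝ → ℝ := IccExtend hab.le ((Icc a b).domRestrict ω)
  have hW_cont : Continuous W := (continuousOn_iff_continuous_domRestrict.1 hω).Icc_extend'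
  have hWω : ∀ θ ∈ Icc a b, W θ = ω θ := fun θ hθ => IccExtend_of_mem hab.le _ hθ
  have hW_pos : ∀ θ, 0 < W θ := fun θ => hpos _ (projIcc a b hab.le θ).2
  obtain ⟨C, hC⟩ := isCompact_Icc.exists_bound_of_continuousOn hω
  have hW_le : ∀ θ, W θ ≤ C := fun θ =>
    (Real.le_norm_self _).trans (hC _ (projIcc a b hab.le θ).2)
  obtain ⟨e, he⟩ := exists_orderIso_hasDerivAt (hW_cont.inv₀ fun θ => (hW_pos θ).ne')
    (inv_pos.2 ((hW_pos a).trans_le (hW_le a))) fun θ => inv_anti₀ (hW_pos θ) (hW_le θ)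
  have he_symm : ∀ u, HasDerivAt e.symm (W (e.symm u)) u := fun u => by
    simpa only [Pi.inv_apply, inv_inv] using
      HasDerivAt.of_local_left_inverse e.symm.continuous.continuousAt (he _)
        (inv_ne_zero (hW_pos _).ne') (Eventually.of_forall e.apply_symm_apply)
  set ϑ : ℝ → ℝ := fun t => e.symm (e b - t) with hϑ
  have hanti : StrictAnti ϑ := fun s t hst => e.symm.strictMono (sub_lt_sub_left hst _)
  have hϑ0 : ϑ 0 = b := by rw [hϑ]; simp only [sub_zero, e.symm_apply_apply]
  have hϑT : ϑ (e b - e a) = a := by rw [hϑ]; simp only [sub_sub_cancel, e.symm_apply_apply]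
  refine ⟨e b - e a, sub_pos.2 (e.strictMono hab), ϑ, hanti, hϑ0, hϑT, fun t ht => ?_⟩
  have hmem : ϑ t ∈ Icc a b :=
    ⟨hϑT ▸ hanti.antitone ht.2, hϑ0 ▸ hanti.antitone ht.1⟩
  beta_reduce
  rw [← hWω _ hmem, ← mul_neg_one]
  exact ((he_symm (e b - t)).comp t ((hasDerivAt_id t).const_sub (e b))).hasDerivWithinAt

end Reparametrization

section Scale

variable {d : ℕ} {lam : Fin d → ℂ} {ρ : ℝ}

theorem existsUnique_isScale (hlam : lam ≠ 0) : ∃! ρ : ℝ, IsScale lam ρ := by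
  obtain ⟨j, hj⟩ := Function.ne_iff.1 hlam
  have hj_pos : 0 < ‖lam j‖ := norm_pos_iff.2 hj
  set f : ℝ → ℝ := fun ρ => ∑ i : Fin d, ρ ^ (i.val + 1) * ‖lam i‖ with hf
  have hf_cont : Continuous f := by fun_prop
  have hf_mono : StrictMonoOn f (Ici 0) := fun x hx y _ hxy => by
    have hx0 : 0 ≤ x := hx
    refine Finset.sum_lt_sum (fun i _ => by gcongr) ⟨j, Finset.mem_univ j, ?_⟩
    exact mul_lt_mul_of_pos_right (pow_lt_pow_left₀ hxy hx0 j.val.succ_ne_zero) hj_pos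
  have hf_zero : f 0 = 0 := by simp [hf]
  set B := max 1 ‖lam j‖⁻¹
  have hB_one : 1 ≤ B := le_max_left _ _
  have hf_one_le : 1 ≤ f B :=
    calc 1 = ‖lam j‖⁻¹ * ‖lam j‖ := (inv_mul_cancel₀ hj_pos.ne').symm
      _ ≤ B ^ (j.val + 1) * ‖lam j‖ := by
        gcongr
        exact (le_max_right _ _).trans (le_self_pow₀ hB_one j.val.succ_ne_zero)
      _ ≤ f B := Finset.single_le_sum (f := fun i : Fin d => B ^ (i.val + 1) * ‖lam i‖)
        (fun i _ => by positivity) (Finset.mem_univ j)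
  obtain ⟨ρ, hρ, hρ_one⟩ : (1 : ℝ) ∈ f '' Icc 0 B :=
    intermediate_value_Icc (zero_le_one.trans hB_one) hf_cont.continuousOn
      ⟨hf_zero.trans_le zero_le_one, hf_one_le⟩
  have hρ_ne : ρ ≠ 0 := by
    rintro rfl
    exact zero_ne_one (hf_zero.symm.trans hρ_one)
  exact ⟨ρ, ⟨hρ.1.lt_of_ne' hρ_ne, hρ_one⟩, fun σ hσ =>
    hf_mono.injOn hσ.1.le hρ.1 (hσ.2.trans hρ_one.symm)⟩

theorem IsScale.two_lt_of_sum_lt (h : IsScale lam ρ) (hsmall : ∑ i, ‖lam i‖ < (1 / 2) ^ d) :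
    2 < ρ := by
  by_contra! hle
  have hpow : ∀ i : Fin d, ρ ^ (i.val + 1) ≤ 2 ^ d := fun i =>
    (pow_le_pow_left₀ h.1.le hle _).trans (pow_le_pow_right₀ one_le_two i.2)
  refine lt_irrefl (1 : ℝ) ?_
  calc 1 = ∑ i : Fin d, ρ ^ (i.val + 1) * ‖lam i‖ := h.2.symm
    _ ≤ ∑ i : Fin d, 2 ^ d * ‖lam i‖ := by gcongr with i; exact hpow i
    _ = 2 ^ d * ∑ i, ‖lam i‖ := Finset.mul_sum _ _ _ |>.symm
    _ < 2 ^ d * (1 / 2) ^ d := by gcongr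
    _ = 1 := by rw [← mul_pow, mul_one_div_cancel two_ne_zero, one_pow]

theorem IsScale.one_div_one_add_lt (h : IsScale lam ρ) (hsmall : ∑ i, ‖lam i‖ < (1 / 2) ^ d) :
    1 / (1 + ∑ i, ‖lam i‖) < ρ / 2 := by
  have hsum : 0 ≤ ∑ i, ‖lam i‖ := Finset.sum_nonneg fun i _ => norm_nonneg _
  calc 1 / (1 + ∑ i, ‖lam i‖) ≤ 1 := (div_le_one (by positivity)).2 (le_add_of_nonneg_right hsum)
    _ < ρ / 2 := (one_lt_div two_pos).2 (h.two_lt_of_sum_lt hsmall)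

theorem exists_isScale_lt_one_div (hd : 1 ≤ d) (M : ℝ) :
    ∃ mu : Fin d → ℝ, M < ∑ i, |mu i| ∧
      ∃ ρ : ℝ, IsScale (fun i => (mu i : ℂ)) ρ ∧ ρ / 2 < 1 / (1 + ∑ i, |mu i|) := by
  obtain ⟨n, rfl⟩ := Nat.exists_eq_add_of_le' hd
  obtain ⟨m, hm⟩ := exists_gt (max M 1)
  obtain ⟨hMm, hm_one⟩ := max_lt_iff.1 hm
  have hm_pos : 0 < m := one_pos.trans hm_one
  have hsum : ∑ i, |(Pi.single 0 m : Fin (n + 1) → ℝ) i| = m := by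
    simp [Fin.sum_univ_succ, abs_of_pos hm_pos]
  refine ⟨Pi.single 0 m, hsum.symm ▸ hMm, m⁻¹, ⟨inv_pos.2 hm_pos, ?_⟩, ?_⟩
  · simp [Fin.sum_univ_succ, abs_of_pos hm_pos, hm_pos.ne']
  · rw [hsum, inv_eq_one_div, div_div, one_div_lt_one_div (by positivity) (by positivity)]
    linarith

end Scale

section PolarEquation

theorem pow_le_pow_mul_div_pow {x ρ : ℝ} (hx : 0 ≤ x) (hρ : 0 < ρ) (hle : x ≤ ρ) {m k : ℕ}
    (hmk : m ≤ k) : x ^ k ≤ ρ ^ k * (x / ρ) ^ m :=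
  calc x ^ k = ρ ^ k * (x / ρ) ^ k := by rw [← mul_pow, mul_div_cancel₀ x hρ.ne']
    _ ≤ ρ ^ k * (x / ρ) ^ m := by
      gcongr ρ ^ k * ?_
      exact pow_le_pow_of_le_one (by positivity) ((div_le_one hρ).2 hle) hmk

theorem five_mul_abs_sin_mul_cos_le (θ : ℝ) :
    5 * |Real.sin θ * Real.cos θ| ≤ 4 * (1 - |Real.sin θ| * Real.cos θ ^ 2) := by
  rw [abs_mul, ← sq_abs (Real.cos θ)]
  have hsq : |Real.sin θ| ^ 2 + |Real.cos θ| ^ 2 = 1 := by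
    rw [sq_abs, sq_abs, Real.sin_sq_add_cos_sq]
  generalize |Real.sin θ| = x at *
  generalize |Real.cos θ| = y at *
  -- The sides are closest, about `0.03` apart, near `x = 16 / 25`, where the squares are small.
  nlinarith [sq_nonneg (6 * x - 5 * y), sq_nonneg (y * (x - 16 / 25)),
    sq_nonneg (y ^ 2 - 558 / 1000)]

theorem one_sub_abs_sin_mul_cos_sq_pos (θ : ℝ) : 0 < 1 - |Real.sin θ| * Real.cos θ ^ 2 := by
  rcases eq_or_ne (Real.sin θ * Real.cos θ) 0 with h | h
  · rw [sq, ← abs_mul_abs_self (Real.cos θ), ← mul_assoc, ← abs_mul, h, abs_zero, zero_mul,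
      sub_zero]
    exact one_pos
  · linarith [five_mul_abs_sin_mul_cos_le θ, abs_pos.2 h]

variable {d : ℕ} {lam : Fin d → ℂ} {ρ : ℝ} {x y : ℂ}

theorem norm_lienardPoly_le (h : IsScale lam ρ) (hx : ‖x‖ ≤ ρ) :
    ‖lienardPoly lam x‖ ≤ ‖x‖ / ρ :=
  calc ‖lienardPoly lam x‖ ≤ ∑ i : Fin d, ‖lam i‖ * ‖x‖ ^ (i.val + 1) := by
        simpa only [lienardPoly, norm_mul, norm_pow] using
          norm_sum_le Finset.univ fun i => lam i * x ^ (i.val + 1)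
    _ ≤ ∑ i : Fin d, ‖lam i‖ * (ρ ^ (i.val + 1) * (‖x‖ / ρ) ^ 1) := by
      gcongr with i
      exact pow_le_pow_mul_div_pow (norm_nonneg x) h.1 hx (Nat.le_add_left _ _)
    _ = (∑ i : Fin d, ρ ^ (i.val + 1) * ‖lam i‖) * (‖x‖ / ρ) := by
      rw [Finset.sum_mul]
      exact Finset.sum_congr rfl fun i _ => by ring
    _ = ‖x‖ / ρ := by rw [h.2, one_mul]

theorem norm_mul_cos (x : ℂ) (θ : ℝ) : ‖x * (Real.cos θ : ℂ)‖ = ‖x‖ * |Real.cos θ| := by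
  rw [norm_mul, Complex.norm_real, Real.norm_eq_abs]

theorem norm_mul_cos_le (x : ℂ) (θ : ℝ) : ‖x * (Real.cos θ : ℂ)‖ ≤ ‖x‖ :=
  norm_mul_cos x θ ▸ mul_le_of_le_one_right (norm_nonneg x) (Real.abs_cos_le_one θ)

theorem norm_lienardPoly_mul_cos_le (h : IsScale lam ρ) (hx : ‖x‖ ≤ ρ) (θ : ℝ) :
    ‖lienardPoly lam (x * Real.cos θ)‖ ≤ ‖x‖ / ρ * |Real.cos θ| :=
  (norm_lienardPoly_le h ((norm_mul_cos_le x θ).trans hx)).trans_eq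
    (by rw [norm_mul_cos, div_mul_eq_mul_div])

theorem norm_polarAngular_add_one_le (h : IsScale lam ρ) (hx : ‖x‖ ≤ ρ) (θ : ℝ) :
    ‖polarAngular lam θ x + 1‖ ≤ |Real.sin θ| * Real.cos θ ^ 2 := by
  rw [polarAngular, neg_add_cancel_comm, norm_mul, norm_mul, Complex.norm_real, Complex.norm_real,
    Real.norm_eq_abs, Real.norm_eq_abs, ← sq_abs (Real.cos θ), sq, ← mul_assoc]
  gcongr
  exact (norm_lienardPoly_mul_cos_le h hx θ).trans
    (mul_le_of_le_one_left (abs_nonneg _) ((div_le_one h.1).2 hx))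

theorem one_sub_le_norm_polarAngular (h : IsScale lam ρ) (hx : ‖x‖ ≤ ρ) (θ : ℝ) :
    1 - |Real.sin θ| * Real.cos θ ^ 2 ≤ ‖polarAngular lam θ x‖ := by
  have htriangle := norm_sub_le (polarAngular lam θ x + 1) (polarAngular lam θ x)
  rw [add_sub_cancel_left, norm_one] at htriangle
  linarith [norm_polarAngular_add_one_le h hx θ]

theorem polarAngular_ne_zero (h : IsScale lam ρ) (hx : ‖x‖ ≤ ρ) (θ : ℝ) :
    polarAngular lam θ x ≠ 0 :=
  norm_pos_iff.1 ((one_sub_abs_sin_mul_cos_sq_pos θ).trans_le (one_sub_le_norm_polarAngular h hx θ))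

theorem polarSlope_zero (lam : Fin d → ℂ) (θ : ℝ) : polarSlope lam θ 0 = 0 := by
  simp only [polarSlope, zero_mul, zero_div]

/-- The divided difference of `lienardPoly lam` at `x` and `y`, in the division-free form that also
covers `x = y`. -/
def lienardQuot {K : Type*} [CommSemiring K] (lam : Fin d → K) (x y : K) : K :=
  ∑ i : Fin d, lam i * ∑ j ∈ Finset.range (i.val + 1), x ^ j * y ^ (i.val - j)

theorem lienardPoly_sub {K : Type*} [CommRing K] (lam : Fin d → K) (x y : K) :
    lienardPoly lam x - lienardPoly lam y = lienardQuot lam x y * (x - y) := by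
  simp only [lienardPoly, lienardQuot, Finset.sum_mul, ← Finset.sum_sub_distrib]
  refine Finset.sum_congr rfl fun i _ => ?_
  rw [← mul_sub, ← (Commute.all x y).geom_sum₂_mul, mul_assoc, Nat.add_sub_cancel]

/-- The divided difference of `polarSlope lam θ` at `x` and `y`, written so that it is continuous
across `x = y`. -/
noncomputable def polarQuot (lam : Fin d → ℂ) (θ : ℝ) (x y : ℂ) : ℂ :=
  (Real.sin θ : ℂ) ^ 2 * (lienardPoly lam (x * Real.cos θ) / polarAngular lam θ x -
    y * Real.cos θ * lienardQuot lam (x * Real.cos θ) (y * Real.cos θ) /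
      (polarAngular lam θ x * polarAngular lam θ y))

theorem polarSlope_sub {θ : ℝ} (hx : polarAngular lam θ x ≠ 0) (hy : polarAngular lam θ y ≠ 0) :
    polarSlope lam θ x - polarSlope lam θ y = polarQuot lam θ x y * (x - y) := by
  have hP := lienardPoly_sub lam (x * Real.cos θ) (y * Real.cos θ)
  have hDx : polarAngular lam θ x =
      -1 + Real.sin θ * Real.cos θ * lienardPoly lam (x * Real.cos θ) := rfl
  have hDy : polarAngular lam θ y =
      -1 + Real.sin θ * Real.cos θ * lienardPoly lam (y * Real.cos θ) := rfl
  rw [polarSlope, polarSlope, polarQuot]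
  generalize lienardPoly lam (x * Real.cos θ) = P at *
  generalize lienardPoly lam (y * Real.cos θ) = Q at *
  generalize lienardQuot lam (x * Real.cos θ) (y * Real.cos θ) = L at *
  generalize polarAngular lam θ x = Dx at *
  generalize polarAngular lam θ y = Dy at *
  field_simp
  linear_combination (Real.sin θ : ℂ) ^ 2 * (y * P * hDy - y * Q * hDx - y * hP)

@[fun_prop]
theorem continuous_lienardPoly {K : Type*} [CommSemiring K] [TopologicalSpace K]
    [IsTopologicalSemiring K] (lam : Fin d → K) : Continuous (lienardPoly lam) := by
  unfold lienardPoly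
  fun_prop

@[fun_prop]
theorem continuous_lienardQuot {K : Type*} [CommSemiring K] [TopologicalSpace K]
    [IsTopologicalSemiring K] (lam : Fin d → K) :
    Continuous fun q : K × K => lienardQuot lam q.1 q.2 := by
  unfold lienardQuot
  fun_prop

@[fun_prop]
theorem continuous_polarAngular (lam : Fin d → ℂ) :
    Continuous fun q : ℝ × ℂ => polarAngular lam q.1 q.2 := by
  unfold polarAngular
  fun_prop

theorem isDividedDifferenceOn_polarQuot (h : IsScale lam ρ) (I : Set ℝ) :
    IsDividedDifferenceOn (polarQuot lam) (polarSlope lam) I (closedBall 0 ρ) where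
  sub_eq θ _ x hx y hy :=
    polarSlope_sub (polarAngular_ne_zero h (mem_closedBall_zero_iff.1 hx) θ)
      (polarAngular_ne_zero h (mem_closedBall_zero_iff.1 hy) θ)
  continuousOn := by
    have hne : ∀ q ∈ I ×ˢ closedBall (0 : ℂ) ρ ×ˢ closedBall (0 : ℂ) ρ,
        polarAngular lam q.1 q.2.1 ≠ 0 ∧ polarAngular lam q.1 q.2.2 ≠ 0 := fun q hq =>
      ⟨polarAngular_ne_zero h (mem_closedBall_zero_iff.1 hq.2.1) _,
        polarAngular_ne_zero h (mem_closedBall_zero_iff.1 hq.2.2) _⟩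
    unfold polarQuot
    refine ContinuousOn.mul (by fun_prop) (.sub (.div ?_ ?_ fun q hq => (hne q hq).1)
      (.div ?_ ?_ fun q hq => mul_ne_zero (hne q hq).1 (hne q hq).2)) <;> fun_prop

theorem continuous_polarSlope_left (h : IsScale lam ρ) (hx : ‖x‖ ≤ ρ) :
    Continuous (polarSlope lam · x) := by
  unfold polarSlope
  exact Continuous.div (by fun_prop) (by fun_prop) (polarAngular_ne_zero h hx)

theorem isConfinedIntegralCurve_polarSlope_zero (h : IsScale lam ρ) (I : Set ℝ) :
    IsConfinedIntegralCurve (polarSlope lam) I (closedBall 0 ρ) fun _ => 0 where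
  isIntegralCurveOn θ _ := by
    simpa only [polarSlope_zero] using hasDerivWithinAt_const θ I (0 : ℂ)
  mapsTo _ _ := mem_closedBall_self h.1.le

theorem isReturn_of_isConfinedIntegralCurve (h : IsScale lam ρ) {r : ℝ → ℂ}
    (hr : IsConfinedIntegralCurve (polarSlope lam) (Icc 0 (2 * Real.pi)) (closedBall 0 ρ) r) :
    IsReturn lam (r (2 * Real.pi)) (r 0) :=
  ⟨r, rfl, rfl, fun θ hθ => ⟨polarAngular_ne_zero h (mem_closedBall_zero_iff.1 (hr.mapsTo hθ)) θ,
    hr.isIntegralCurveOn θ hθ⟩⟩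

end PolarEquation

section APriori

variable {n : ℕ} {lam : Fin (n + 1) → ℂ} {ρ : ℝ} {x : ℂ}

theorem IsScale.mul_norm_zero_le_one (h : IsScale lam ρ) : ρ * ‖lam 0‖ ≤ 1 := by
  have hρ := h.1
  rw [← h.2]
  simpa only [Fin.val_zero, zero_add, pow_one] using
    Finset.single_le_sum (f := fun i : Fin (n + 1) => ρ ^ (i.val + 1) * ‖lam i‖)
      (fun i _ => by positivity) (Finset.mem_univ 0)

theorem norm_lienardPoly_sub_linear_le (h : IsScale lam ρ) (hx : ‖x‖ ≤ ρ) :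
    ‖lienardPoly lam x - lam 0 * x‖ ≤ (1 - ρ * ‖lam 0‖) * (‖x‖ / ρ) ^ 2 := by
  have htail : lienardPoly lam x - lam 0 * x = ∑ i : Fin n, lam i.succ * x ^ (i.val + 2) := by
    simp only [lienardPoly, Fin.sum_univ_succ, Fin.val_zero, Fin.val_succ, zero_add, pow_one,
      add_sub_cancel_left]
  have hscale : ∑ i : Fin n, ρ ^ (i.val + 2) * ‖lam i.succ‖ = 1 - ρ * ‖lam 0‖ := by
    rw [eq_sub_iff_add_eq', ← h.2, Fin.sum_univ_succ]
    simp only [Fin.val_zero, Fin.val_succ, zero_add, pow_one]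
  calc ‖lienardPoly lam x - lam 0 * x‖ ≤ ∑ i : Fin n, ‖lam i.succ‖ * ‖x‖ ^ (i.val + 2) := by
        simpa only [htail, norm_mul, norm_pow] using
          norm_sum_le Finset.univ fun i : Fin n => lam i.succ * x ^ (i.val + 2)
    _ ≤ ∑ i : Fin n, ‖lam i.succ‖ * (ρ ^ (i.val + 2) * (‖x‖ / ρ) ^ 2) := by
      gcongr with i
      exact pow_le_pow_mul_div_pow (norm_nonneg x) h.1 hx (Nat.le_add_left _ _)
    _ = (1 - ρ * ‖lam 0‖) * (‖x‖ / ρ) ^ 2 := by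
      rw [← hscale, Finset.sum_mul]
      exact Finset.sum_congr rfl fun i _ => by ring

/-- The reciprocal radius, corrected so that it varies slowly along solutions of the polar
equation, `l` being the coefficient `λ₁` of the linear term of `p`: the derivative of the correction
cancels the term `l sin² θ cos θ`, which is the only one not tending to `0` with the radius. -/
noncomputable def regularizedInv (l : ℂ) (θ : ℝ) (x : ℂ) : ℂ :=
  x⁻¹ - l * ((Real.sin θ : ℂ) ^ 3 / 3)

theorem norm_mul_sin_pow_three_div_three_le (l : ℂ) (θ : ℝ) :
    ‖l * ((Real.sin θ : ℂ) ^ 3 / 3)‖ ≤ ‖l‖ / 3 := by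
  rw [norm_mul, norm_div, norm_pow, Complex.norm_real, Real.norm_eq_abs, Complex.norm_ofNat,
    ← mul_div_assoc]
  gcongr
  exact mul_le_of_le_one_right (norm_nonneg l)
    (pow_le_one₀ (abs_nonneg _) (Real.abs_sin_le_one θ))

theorem norm_regularizedInv_le (l : ℂ) (θ : ℝ) (x : ℂ) :
    ‖regularizedInv l θ x‖ ≤ ‖x‖⁻¹ + ‖l‖ / 3 :=
  (norm_sub_le _ _).trans
    (add_le_add (norm_inv x).le (norm_mul_sin_pow_three_div_three_le l θ))

theorem norm_regularizedInv_mul_norm_le (l : ℂ) (hx0 : x ≠ 0) (hx : ‖x‖ ≤ ρ) (θ : ℝ) :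
    ‖regularizedInv l θ x‖ * ‖x‖ ≤ 1 + ρ * ‖l‖ / 3 :=
  calc ‖regularizedInv l θ x‖ * ‖x‖ ≤ (‖x‖⁻¹ + ‖l‖ / 3) * ‖x‖ := by
        gcongr
        exact norm_regularizedInv_le _ _ _
    _ = 1 + ‖x‖ * ‖l‖ / 3 := by
      rw [add_mul, inv_mul_cancel₀ (norm_ne_zero_iff.2 hx0)]
      ring
    _ ≤ 1 + ρ * ‖l‖ / 3 := by gcongr

theorem hasDerivWithinAt_regularizedInv (l : ℂ) {r : ℝ → ℂ} {r' : ℂ} {I : Set ℝ} {θ : ℝ}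
    (hr : HasDerivWithinAt r r' I θ) (hne : r θ ≠ 0) :
    HasDerivWithinAt (fun θ => regularizedInv l θ (r θ))
      (-r' / r θ ^ 2 - l * ((Real.sin θ : ℂ) ^ 2 * Real.cos θ)) I θ := by
  have hsin : HasDerivAt (fun θ : ℝ => l * ((Real.sin θ : ℂ) ^ 3 / 3))
      (l * ((Real.sin θ : ℂ) ^ 2 * Real.cos θ)) θ := by
    refine ((((Real.hasDerivAt_sin θ).ofReal_comp.pow 3).div_const 3).const_mul l).congr_deriv ?_
    push_cast
    ring
  exact (hr.inv hne).sub hsin.hasDerivWithinAt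

theorem neg_polarSlope_div_sq_sub {d : ℕ} {lam : Fin d → ℂ} (l : ℂ) {θ : ℝ} (hx0 : x ≠ 0)
    (hD : polarAngular lam θ x ≠ 0) :
    -polarSlope lam θ x / x ^ 2 - l * ((Real.sin θ : ℂ) ^ 2 * Real.cos θ) =
      (Real.sin θ : ℂ) ^ 2 * (lienardPoly lam (x * Real.cos θ) - l * (x * Real.cos θ)) / x -
        (Real.sin θ : ℂ) ^ 3 * Real.cos θ * lienardPoly lam (x * Real.cos θ) ^ 2 /
          (x * polarAngular lam θ x) := by
  have hD' : polarAngular lam θ x =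
      -1 + Real.sin θ * Real.cos θ * lienardPoly lam (x * Real.cos θ) := rfl
  rw [polarSlope]
  generalize lienardPoly lam (x * Real.cos θ) = P at *
  generalize polarAngular lam θ x = D at *
  field_simp
  linear_combination -(Real.sin θ : ℂ) ^ 2 * P * hD'

theorem norm_sin_cube_mul_lienardPoly_sq_div_le (h : IsScale lam ρ) (hx0 : x ≠ 0) (hx : ‖x‖ ≤ ρ)
    (θ : ℝ) :
    ‖(Real.sin θ : ℂ) ^ 3 * Real.cos θ * lienardPoly lam (x * Real.cos θ) ^ 2 /
      (x * polarAngular lam θ x)‖ ≤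
        ‖x‖ / ρ ^ 2 * (Real.sin θ ^ 2 * Real.cos θ ^ 2 * (4 / 5)) := by
  have hpos : 0 < ‖x‖ := norm_pos_iff.2 hx0
  have hD : 5 * |Real.sin θ * Real.cos θ| ≤ 4 * ‖polarAngular lam θ x‖ :=
    (five_mul_abs_sin_mul_cos_le θ).trans
      (mul_le_mul_of_nonneg_left (one_sub_le_norm_polarAngular h hx θ) (by norm_num))
  rw [norm_div, norm_mul, norm_mul, norm_mul, norm_pow, norm_pow, Complex.norm_real,
    Complex.norm_real, Real.norm_eq_abs, Real.norm_eq_abs,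
    div_le_iff₀ (mul_pos hpos (norm_pos_iff.2 (polarAngular_ne_zero h hx θ)))]
  calc |Real.sin θ| ^ 3 * |Real.cos θ| * ‖lienardPoly lam (x * Real.cos θ)‖ ^ 2
      ≤ |Real.sin θ| ^ 3 * |Real.cos θ| * (‖x‖ / ρ * |Real.cos θ|) ^ 2 := by
        gcongr
        exact norm_lienardPoly_mul_cos_le h hx θ
    _ = ‖x‖ ^ 2 / ρ ^ 2 * (|Real.sin θ| ^ 2 * |Real.cos θ| ^ 2) * |Real.sin θ * Real.cos θ| := by
      rw [abs_mul]
      ring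
    _ ≤ ‖x‖ ^ 2 / ρ ^ 2 * (|Real.sin θ| ^ 2 * |Real.cos θ| ^ 2) *
        (4 / 5 * ‖polarAngular lam θ x‖) := by
      gcongr
      linarith
    _ = _ := by
      rw [sq_abs, sq_abs]
      ring

theorem norm_neg_polarSlope_div_sq_sub_le (h : IsScale lam ρ) (hx0 : x ≠ 0) (hx : ‖x‖ ≤ ρ) (θ : ℝ) :
    ‖-polarSlope lam θ x / x ^ 2 - lam 0 * ((Real.sin θ : ℂ) ^ 2 * Real.cos θ)‖ ≤
      ‖x‖ / ρ ^ 2 * (Real.sin θ ^ 2 * Real.cos θ ^ 2 * (9 / 5 - ρ * ‖lam 0‖)) := by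
  have hpos : 0 < ‖x‖ := norm_pos_iff.2 hx0
  have hlinear : ‖(Real.sin θ : ℂ) ^ 2 *
      (lienardPoly lam (x * Real.cos θ) - lam 0 * (x * Real.cos θ)) / x‖ ≤
        ‖x‖ / ρ ^ 2 * (Real.sin θ ^ 2 * Real.cos θ ^ 2 * (1 - ρ * ‖lam 0‖)) := by
    rw [norm_div, norm_mul, norm_pow, Complex.norm_real, Real.norm_eq_abs, sq_abs,
      div_le_iff₀ hpos]
    calc Real.sin θ ^ 2 * ‖lienardPoly lam (x * Real.cos θ) - lam 0 * (x * Real.cos θ)‖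
        ≤ Real.sin θ ^ 2 * ((1 - ρ * ‖lam 0‖) * (‖x * Real.cos θ‖ / ρ) ^ 2) := by
          gcongr
          exact norm_lienardPoly_sub_linear_le h ((norm_mul_cos_le x θ).trans hx)
      _ = _ := by
        rw [norm_mul_cos, div_pow, mul_pow, sq_abs]
        ring
  rw [neg_polarSlope_div_sq_sub (lam 0) hx0 (polarAngular_ne_zero h hx θ)]
  refine (norm_sub_le _ _).trans ((add_le_add hlinear
    (norm_sin_cube_mul_lienardPoly_sq_div_le h hx0 hx θ)).trans_eq ?_)
  ring

theorem norm_two_mul_regularizedInv_mul_le (h : IsScale lam ρ) (hx0 : x ≠ 0) (hx : ‖x‖ ≤ ρ)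
    (θ : ℝ) :
    ‖2 * regularizedInv (lam 0) θ x *
      (-polarSlope lam θ x / x ^ 2 - lam 0 * ((Real.sin θ : ℂ) ^ 2 * Real.cos θ))‖ ≤
        2 * (1 + ρ * ‖lam 0‖ / 3) * (9 / 5 - ρ * ‖lam 0‖) / ρ ^ 2 *
          (Real.sin θ ^ 2 * Real.cos θ ^ 2) := by
  have hcoeff : 0 ≤ 9 / 5 - ρ * ‖lam 0‖ := by linarith [h.mul_norm_zero_le_one]
  rw [norm_mul, norm_mul, Complex.norm_ofNat]
  calc _ ≤ 2 * ‖regularizedInv (lam 0) θ x‖ * (‖x‖ / ρ ^ 2 *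
        (Real.sin θ ^ 2 * Real.cos θ ^ 2 * (9 / 5 - ρ * ‖lam 0‖))) := by
        gcongr
        exact norm_neg_polarSlope_div_sq_sub_le h hx0 hx θ
    _ = 2 * (‖regularizedInv (lam 0) θ x‖ * ‖x‖) / ρ ^ 2 *
        (Real.sin θ ^ 2 * Real.cos θ ^ 2 * (9 / 5 - ρ * ‖lam 0‖)) := by ring
    _ ≤ 2 * (1 + ρ * ‖lam 0‖ / 3) / ρ ^ 2 *
        (Real.sin θ ^ 2 * Real.cos θ ^ 2 * (9 / 5 - ρ * ‖lam 0‖)) := by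
      gcongr
      exact norm_regularizedInv_mul_norm_le _ hx0 hx θ
    _ = _ := by ring

theorem integral_sin_sq_mul_cos_sq_le {c : ℝ} (hc : 0 ≤ c) :
    ∫ θ in c..2 * Real.pi, Real.sin θ ^ 2 * Real.cos θ ^ 2 ≤ Real.pi / 4 := by
  have hsin : Real.sin (4 * (2 * Real.pi)) = 0 := by
    simpa only [Nat.cast_ofNat, mul_assoc, show (4 : ℝ) * 2 = 8 by norm_num, ← mul_assoc] using
      Real.sin_nat_mul_pi 8
  rw [integral_sin_sq_mul_cos_sq, hsin]
  linarith [Real.sin_le (mul_nonneg zero_le_four hc)]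

theorem sq_one_add_div_three_le {α : ℝ} (h0 : 0 ≤ α) (h1 : α ≤ 1) :
    (1 + α / 3) ^ 2 ≤ 4 - 2 * (1 + α / 3) * (9 / 5 - α) * (Real.pi / 4) := by
  have hcoeff : 0 ≤ (1 + α / 3) * (9 / 5 - α) := mul_nonneg (by linarith) (by linarith)
  have hpi : (1 + α / 3) * (9 / 5 - α) * Real.pi ≤ (1 + α / 3) * (9 / 5 - α) * 3.1416 := by
    gcongr
    exact Real.pi_lt_d4.le
  nlinarith [mul_nonneg h0 (sub_nonneg.2 h1)]

theorem norm_regularizedInv_sq_sub_sq_le (h : IsScale lam ρ) {c : ℝ}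
    (hc : c ∈ Icc 0 (2 * Real.pi)) {r : ℝ → ℂ}
    (hr : IsConfinedIntegralCurve (polarSlope lam) (Icc c (2 * Real.pi)) (closedBall 0 ρ) r)
    (hne : ∀ θ ∈ Icc c (2 * Real.pi), r θ ≠ 0) :
    ‖regularizedInv (lam 0) (2 * Real.pi) (r (2 * Real.pi)) ^ 2 -
      regularizedInv (lam 0) c (r c) ^ 2‖ ≤
        2 * (1 + ρ * ‖lam 0‖ / 3) * (9 / 5 - ρ * ‖lam 0‖) / ρ ^ 2 * (Real.pi / 4) := by
  have hα := h.mul_norm_zero_le_one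
  have hρ := h.1
  set C := 2 * (1 + ρ * ‖lam 0‖ / 3) * (9 / 5 - ρ * ‖lam 0‖) / ρ ^ 2
  have hC0 : 0 ≤ C := div_nonneg (mul_nonneg (by positivity) (by linarith)) (by positivity)
  set V : ℝ → ℂ := fun θ => regularizedInv (lam 0) θ (r θ)
  have hV : ∀ θ ∈ Icc c (2 * Real.pi), HasDerivWithinAt V (-polarSlope lam θ (r θ) / r θ ^ 2 -
      lam 0 * ((Real.sin θ : ℂ) ^ 2 * Real.cos θ)) (Icc c (2 * Real.pi)) θ := fun θ hθ =>
    hasDerivWithinAt_regularizedInv _ (hr.isIntegralCurveOn θ hθ) (hne θ hθ)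
  have hV_sq : ∀ θ ∈ Ioo c (2 * Real.pi), HasDerivAt (fun θ => V θ ^ 2)
      (2 * V θ * (-polarSlope lam θ (r θ) / r θ ^ 2 -
        lam 0 * ((Real.sin θ : ℂ) ^ 2 * Real.cos θ))) θ := fun θ hθ => by
    simpa only [Nat.cast_ofNat, Nat.add_one_sub_one, pow_one] using
      ((hV θ (Ioo_subset_Icc_self hθ)).hasDerivAt (Icc_mem_nhds hθ.1 hθ.2)).fun_pow 2
  have hbound : ∀ θ ∈ Ioo c (2 * Real.pi),
      ‖deriv (fun θ => V θ ^ 2) θ‖ ≤ C * (Real.sin θ ^ 2 * Real.cos θ ^ 2) := fun θ hθ => by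
    have hθ' := Ioo_subset_Icc_self hθ
    rw [(hV_sq θ hθ).deriv]
    exact norm_two_mul_regularizedInv_mul_le h (hne θ hθ')
      (mem_closedBall_zero_iff.1 (hr.mapsTo hθ')) θ
  refine (norm_sub_le_integral_of_norm_deriv_le_of_le hc.2
    (fun θ hθ => (hV θ hθ).continuousWithinAt.pow 2)
    (fun θ hθ => (hV_sq θ hθ).differentiableAt.differentiableWithinAt)
    (Eventually.of_forall hbound)
    (Continuous.intervalIntegrable (by fun_prop) _ _)).trans ?_
  rw [intervalIntegral.integral_const_mul]
  gcongr
  exact integral_sin_sq_mul_cos_sq_le hc.1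

theorem norm_lt_scale_of_norm_two_pi_lt_half (h : IsScale lam ρ) {c : ℝ}
    (hc : c ∈ Icc 0 (2 * Real.pi)) {r : ℝ → ℂ}
    (hr : IsConfinedIntegralCurve (polarSlope lam) (Icc c (2 * Real.pi)) (closedBall 0 ρ) r)
    (hend : ‖r (2 * Real.pi)‖ < ρ / 2) : ‖r c‖ < ρ := by
  have hρ := h.1
  have hr_exp := fun θ (hθ : θ ∈ Icc c (2 * Real.pi)) =>
    (isDividedDifferenceOn_polarQuot h _).sub_eq_mul_exp hr
      (isConfinedIntegralCurve_polarSlope_zero h _) (right_mem_Icc.2 hc.2) hθ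
  simp only [sub_zero] at hr_exp
  rcases eq_or_ne (r (2 * Real.pi)) 0 with hz | hz
  · rwa [hr_exp c (left_mem_Icc.2 hc.2), hz, zero_mul, norm_zero]
  have hne : ∀ θ ∈ Icc c (2 * Real.pi), r θ ≠ 0 := fun θ hθ =>
    hr_exp θ hθ ▸ mul_ne_zero hz (Complex.exp_ne_zero _)
  have hdrift := (norm_sub_norm_le _ _).trans (norm_regularizedInv_sq_sub_sq_le h hc hr hne)
  have hend_sq : 4 / ρ ^ 2 < ‖regularizedInv (lam 0) (2 * Real.pi) (r (2 * Real.pi)) ^ 2‖ := by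
    have hinv : (ρ / 2)⁻¹ < ‖r (2 * Real.pi)‖⁻¹ := inv_strictAnti₀ (norm_pos_iff.2 hz) hend
    have hsq : (ρ / 2)⁻¹ ^ 2 < ‖r (2 * Real.pi)‖⁻¹ ^ 2 := by gcongr
    simpa [regularizedInv, div_pow, show (2 : ℝ) ^ 2 = 4 by norm_num] using hsq
  have hstart : (ρ⁻¹ + ‖lam 0‖ / 3) ^ 2 < ‖regularizedInv (lam 0) c (r c)‖ ^ 2 := by
    have hmargin := div_le_div_of_nonneg_right
      (sq_one_add_div_three_le (mul_nonneg hρ.le (norm_nonneg (lam 0))) h.mul_norm_zero_le_one)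
      (sq_nonneg ρ)
    have hscale : (ρ⁻¹ + ‖lam 0‖ / 3) ^ 2 = (1 + ρ * ‖lam 0‖ / 3) ^ 2 / ρ ^ 2 := by field_simp
    rw [sub_div, mul_div_right_comm _ (Real.pi / 4)] at hmargin
    rw [hscale, ← norm_pow]
    linarith
  have hinv : ρ⁻¹ < ‖r c‖⁻¹ := by
    have hlt := lt_of_pow_lt_pow_left₀ 2 (norm_nonneg _) hstart
    linarith [norm_regularizedInv_le (lam 0) c (r c)]
  exact (inv_lt_inv₀ hρ (norm_pos_iff.2 (hne c (left_mem_Icc.2 hc.2)))).1 hinv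

end APriori

section ReturnMapping

variable {d : ℕ} {lam : Fin d → ℂ} {ρ : ℝ}

theorem exists_isConfinedIntegralCurve_polarSlope (h : IsScale lam ρ) {z : ℂ} (hz : ‖z‖ < ρ / 2) :
    ∃ r, IsConfinedIntegralCurve (polarSlope lam) (Icc 0 (2 * Real.pi)) (closedBall 0 ρ) r ∧
      r (2 * Real.pi) = z := by
  cases d with
  | zero => exact absurd h.2 (by simp)
  | succ n =>
    obtain ⟨L, hL⟩ := (isDividedDifferenceOn_polarQuot h _).exists_lipschitzOnWith
      (isCompact_Icc (a := 0) (b := 2 * Real.pi)) (isCompact_closedBall 0 ρ)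
    exact exists_isConfinedIntegralCurve_of_apriori_bound Real.two_pi_pos.le hL
      (fun x hx => (continuous_polarSlope_left h (mem_closedBall_zero_iff.1 hx)).continuousOn)
      (hz.trans (half_lt_self h.1))
      fun c hc r hr hrz => norm_lt_scale_of_norm_two_pi_lt_half h hc hr (hrz ▸ hz)

theorem exists_hasSum_polarSlope_initial_value (h : IsScale lam ρ) :
    ∃ a : ℕ → ℂ, ∀ z : ℂ, ‖z‖ < ρ / 2 → ∃ r,
      IsConfinedIntegralCurve (polarSlope lam) (Icc 0 (2 * Real.pi)) (closedBall 0 ρ) r ∧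
        r (2 * Real.pi) = z ∧ HasSum (fun k => a k * z ^ k) (r 0) := by
  choose! r hr using fun z (hz : ‖z‖ < ρ / 2) => exists_isConfinedIntegralCurve_polarSlope h hz
  simp only [← mem_ball_zero_iff] at hr ⊢
  have hdiff : DifferentiableOn ℂ (fun z => r z 0) (ball 0 (ρ / 2)) := fun z hz =>
    ((isDividedDifferenceOn_polarQuot h _).hasDerivAt_initial_value (isCompact_closedBall 0 ρ)
      (right_mem_Icc.2 Real.two_pi_pos.le) (isOpen_ball.mem_nhds hz) hr
      (left_mem_Icc.2 Real.two_pi_pos.le)).differentiableAt.differentiableWithinAt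
  refine ⟨fun k => (k.factorial : ℂ)⁻¹ * iteratedDeriv k (fun z => r z 0) 0, fun z hz =>
    ⟨r z, (hr z hz).1, (hr z hz).2, ?_⟩⟩
  simpa only [sub_zero, smul_eq_mul, mul_assoc, mul_comm (z ^ _)] using
    Complex.hasSum_taylorSeries_on_ball hdiff hz

end ReturnMapping

section RealParameters

variable {d : ℕ} {mu : Fin d → ℝ} {ρ : ℝ}

/-- The rate `-dθ/dt` at which the trajectory of `lienardField mu` through the point with polar
coordinates `(x, θ)` turns clockwise. -/
noncomputable def clockwiseSpeed (mu : Fin d → ℝ) (θ x : ℝ) : ℝ :=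
  1 - Real.sin θ * Real.cos θ * lienardPoly mu (x * Real.cos θ)

/-- The right-hand side of the polar equation for real parameters and a real radius. -/
noncomputable def realPolarSlope (mu : Fin d → ℝ) (θ x : ℝ) : ℝ :=
  -(x * lienardPoly mu (x * Real.cos θ) * Real.sin θ ^ 2 / clockwiseSpeed mu θ x)

theorem ofReal_lienardPoly (mu : Fin d → ℝ) (x : ℝ) :
    ((lienardPoly mu x : ℝ) : ℂ) = lienardPoly (fun i => (mu i : ℂ)) (x : ℂ) := by
  simp only [lienardPoly, Complex.ofReal_sum, Complex.ofReal_mul, Complex.ofReal_pow]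

theorem ofReal_clockwiseSpeed (mu : Fin d → ℝ) (θ x : ℝ) :
    (clockwiseSpeed mu θ x : ℂ) = -polarAngular (fun i => (mu i : ℂ)) θ x := by
  rw [clockwiseSpeed, polarAngular, ← Complex.ofReal_mul x, ← ofReal_lienardPoly]
  push_cast
  ring

theorem ofReal_realPolarSlope (mu : Fin d → ℝ) (θ x : ℝ) :
    (realPolarSlope mu θ x : ℂ) = polarSlope (fun i => (mu i : ℂ)) θ x := by
  rw [realPolarSlope, polarSlope, ← neg_neg (polarAngular _ θ _), ← ofReal_clockwiseSpeed,
    ← Complex.ofReal_mul x, ← ofReal_lienardPoly, div_neg]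
  push_cast
  rfl

theorem clockwiseSpeed_pos (h : IsScale (fun i => (mu i : ℂ)) ρ) {x : ℝ} (hx : ‖(x : ℂ)‖ ≤ ρ)
    (θ : ℝ) : 0 < clockwiseSpeed mu θ x := by
  have hre := ((Complex.re_le_norm _).trans (norm_polarAngular_add_one_le h hx θ))
  rw [← neg_neg (polarAngular _ θ _), ← ofReal_clockwiseSpeed, Complex.add_re, Complex.neg_re,
    Complex.ofReal_re, Complex.one_re] at hre
  linarith [one_sub_abs_sin_mul_cos_sq_pos θ]

theorem conj_polarSlope (mu : Fin d → ℝ) (θ : ℝ) (x : ℂ) :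
    (starRingEnd ℂ) (polarSlope (fun i => (mu i : ℂ)) θ x) =
      polarSlope (fun i => (mu i : ℂ)) θ ((starRingEnd ℂ) x) := by
  simp only [polarSlope, polarAngular, lienardPoly, map_div₀, map_mul, map_pow, map_add, map_neg,
    map_one, map_sum, Complex.conj_ofReal]

section Curve

variable {r : ℝ → ℂ} {x θ : ℝ}

theorem IsConfinedIntegralCurve.conj {I : Set ℝ}
    (hr : IsConfinedIntegralCurve (polarSlope fun i => (mu i : ℂ)) I (closedBall 0 ρ) r) :
    IsConfinedIntegralCurve (polarSlope fun i => (mu i : ℂ)) I (closedBall 0 ρ)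
      fun θ => (starRingEnd ℂ) (r θ) where
  isIntegralCurveOn θ hθ := by
    rw [← conj_polarSlope]
    exact Complex.conjCLE.toContinuousLinearMap.hasFDerivAt.comp_hasDerivWithinAt θ
      (hr.isIntegralCurveOn θ hθ)
  mapsTo θ hθ := by
    rw [mem_closedBall_zero_iff, Complex.norm_conj]
    exact mem_closedBall_zero_iff.1 (hr.mapsTo hθ)

theorem IsConfinedIntegralCurve.ofReal_re (h : IsScale (fun i => (mu i : ℂ)) ρ)
    (hr : IsConfinedIntegralCurve (polarSlope fun i => (mu i : ℂ)) (Icc 0 (2 * Real.pi))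
      (closedBall 0 ρ) r) (hrx : r (2 * Real.pi) = x) (hθ : θ ∈ Icc 0 (2 * Real.pi)) :
    ((r θ).re : ℂ) = r θ := by
  have hdiff := (isDividedDifferenceOn_polarQuot h _).sub_eq_mul_exp hr hr.conj
    (right_mem_Icc.2 Real.two_pi_pos.le) hθ
  rw [hrx, Complex.conj_ofReal, sub_self, zero_mul, sub_eq_zero] at hdiff
  exact Complex.conj_eq_iff_re.1 hdiff.symm

theorem IsConfinedIntegralCurve.re_pos (h : IsScale (fun i => (mu i : ℂ)) ρ)
    (hr : IsConfinedIntegralCurve (polarSlope fun i => (mu i : ℂ)) (Icc 0 (2 * Real.pi))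
      (closedBall 0 ρ) r) (hrx : r (2 * Real.pi) = x) (hx : 0 < x)
    (hθ : θ ∈ Icc 0 (2 * Real.pi)) : 0 < (r θ).re := by
  have hne : ∀ η ∈ Icc 0 (2 * Real.pi), (r η).re ≠ 0 := fun η hη h0 => by
    have hexp := (isDividedDifferenceOn_polarQuot h _).sub_eq_mul_exp hr
      (isConfinedIntegralCurve_polarSlope_zero h _) (right_mem_Icc.2 Real.two_pi_pos.le) hη
    rw [← hr.ofReal_re h hrx hη, h0, hrx, Complex.ofReal_zero, sub_zero, sub_zero] at hexp
    exact mul_ne_zero (Complex.ofReal_ne_zero.2 hx.ne') (Complex.exp_ne_zero _) hexp.symm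
  by_contra! hle
  have hcont : ContinuousOn (fun θ => (r θ).re) (Icc θ (2 * Real.pi)) :=
    Complex.continuous_re.comp_continuousOn (hr.continuousOn.mono (Icc_subset_Icc_left hθ.1))
  obtain ⟨η, hη, hη0⟩ := intermediate_value_Icc hθ.2 hcont
    ⟨hle, by simpa only [hrx, Complex.ofReal_re] using hx.le⟩
  exact hne η ⟨hθ.1.trans hη.1, hη.2⟩ hη0

theorem IsConfinedIntegralCurve.isIntegralCurveOn_re (h : IsScale (fun i => (mu i : ℂ)) ρ)
    (hr : IsConfinedIntegralCurve (polarSlope fun i => (mu i : ℂ)) (Icc 0 (2 * Real.pi))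
      (closedBall 0 ρ) r) (hrx : r (2 * Real.pi) = x) :
    IsIntegralCurveOn (fun θ => (r θ).re) (realPolarSlope mu) (Icc 0 (2 * Real.pi)) :=
  fun θ hθ => by
    refine (Complex.reCLM.hasFDerivAt.comp_hasDerivWithinAt θ
      (hr.isIntegralCurveOn θ hθ)).congr_deriv ?_
    rw [← hr.ofReal_re h hrx hθ, ← ofReal_realPolarSlope]
    rfl

end Curve

theorem hasDerivWithinAt_lienardField_of_polar {R ϑ : ℝ → ℝ} {I : Set ℝ} {t : ℝ}
    (hω : clockwiseSpeed mu (ϑ t) (R t) ≠ 0)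
    (hR : HasDerivWithinAt R
      (realPolarSlope mu (ϑ t) (R t) * -clockwiseSpeed mu (ϑ t) (R t)) I t)
    (hϑ : HasDerivWithinAt ϑ (-clockwiseSpeed mu (ϑ t) (R t)) I t) :
    HasDerivWithinAt (fun t => (R t * Real.cos (ϑ t), R t * Real.sin (ϑ t)))
      (lienardField mu (R t * Real.cos (ϑ t), R t * Real.sin (ϑ t))) I t := by
  refine ((hR.mul hϑ.cos).prodMk (hR.mul hϑ.sin)).congr_deriv ?_
  have hslope : realPolarSlope mu (ϑ t) (R t) * -clockwiseSpeed mu (ϑ t) (R t) =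
      R t * lienardPoly mu (R t * Real.cos (ϑ t)) * Real.sin (ϑ t) ^ 2 := by
    rw [realPolarSlope, neg_mul_neg, div_mul_cancel₀ _ hω]
  have hpyth := Real.sin_sq_add_cos_sq (ϑ t)
  rw [hslope, clockwiseSpeed, lienardField]
  ext
  · ring
  · linear_combination
      R t * lienardPoly mu (R t * Real.cos (ϑ t)) * Real.sin (ϑ t) * hpyth

theorem not_polar_mem_positive_axis {x θ : ℝ} (hx : 0 < x) (hθ : θ ∈ Ioo 0 (2 * Real.pi)) :
    ¬(0 < x * Real.cos θ ∧ x * Real.sin θ = 0) := by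
  rintro ⟨hcos, hsin⟩
  have hcos_pos : 0 < Real.cos θ := (mul_pos_iff_of_pos_left hx).1 hcos
  have hsin_zero : Real.sin θ = 0 := (mul_eq_zero.1 hsin).resolve_left hx.ne'
  have hcos_one : Real.cos θ = 1 :=
    (Real.sin_eq_zero_iff_cos_eq.1 hsin_zero).resolve_right (by linarith)
  exact hθ.1.ne'
    ((Real.cos_eq_one_iff_of_lt_of_lt (by linarith [hθ.1, Real.pi_pos]) hθ.2).1 hcos_one)

theorem isFirstReturn_of_isIntegralCurveOn {R : ℝ → ℝ}
    (hR : IsIntegralCurveOn R (realPolarSlope mu) (Icc 0 (2 * Real.pi)))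
    (hpos : ∀ θ ∈ Icc 0 (2 * Real.pi), 0 < R θ)
    (hω : ∀ θ ∈ Icc 0 (2 * Real.pi), 0 < clockwiseSpeed mu θ (R θ)) :
    IsFirstReturn mu (R (2 * Real.pi)) (R 0) := by
  have hR_cont : ContinuousOn R (Icc 0 (2 * Real.pi)) := fun θ hθ => (hR θ hθ).continuousWithinAt
  have hω_cont : ContinuousOn (fun θ => clockwiseSpeed mu θ (R θ)) (Icc 0 (2 * Real.pi)) := by
    unfold clockwiseSpeed
    fun_prop
  obtain ⟨T, hT, ϑ, hanti, hϑ0, hϑT, hϑ⟩ :=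
    exists_strictAnti_isIntegralCurveOn Real.two_pi_pos hω_cont hω
  have hmaps : MapsTo ϑ (Icc 0 T) (Icc 0 (2 * Real.pi)) := fun t ht =>
    ⟨hϑT ▸ hanti.antitone ht.2, hϑ0 ▸ hanti.antitone ht.1⟩
  refine ⟨hpos _ (right_mem_Icc.2 Real.two_pi_pos.le), hpos _ (left_mem_Icc.2 Real.two_pi_pos.le),
    T, hT, fun t => (R (ϑ t) * Real.cos (ϑ t), R (ϑ t) * Real.sin (ϑ t)),
    fun t ht => ?_, ?_, ?_, fun t ht => ?_⟩
  · exact hasDerivWithinAt_lienardField_of_polar (R := R ∘ ϑ) (hω _ (hmaps ht)).ne'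
      ((hR _ (hmaps ht)).comp t (hϑ t ht) hmaps) (hϑ t ht)
  · simp only [hϑ0, Real.cos_two_pi, Real.sin_two_pi, mul_one, mul_zero]
  · simp only [hϑT, Real.cos_zero, Real.sin_zero, mul_one, mul_zero]
  · exact not_polar_mem_positive_axis (hpos _ (hmaps (Ioo_subset_Icc_self ht)))
      ⟨hϑT ▸ hanti ht.2, hϑ0 ▸ hanti ht.1⟩

theorem IsConfinedIntegralCurve.isFirstReturn (h : IsScale (fun i => (mu i : ℂ)) ρ) {r : ℝ → ℂ}
    (hr : IsConfinedIntegralCurve (polarSlope fun i => (mu i : ℂ)) (Icc 0 (2 * Real.pi))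
      (closedBall 0 ρ) r) {x : ℝ} (hrx : r (2 * Real.pi) = x) (hx : 0 < x) :
    IsFirstReturn mu x (r 0).re := by
  have hreturn := isFirstReturn_of_isIntegralCurveOn (hr.isIntegralCurveOn_re h hrx)
    (fun θ hθ => hr.re_pos h hrx hx hθ) fun θ hθ =>
      clockwiseSpeed_pos h (by
        rw [hr.ofReal_re h hrx hθ]
        exact mem_closedBall_zero_iff.1 (hr.mapsTo hθ)) θ
  rwa [hrx, Complex.ofReal_re] at hreturn

end RealParameters

section ReturnSeries

variable {d : ℕ} {lam : Fin d → ℂ} {ρ : ℝ}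

/-- The power series with coefficients `a` converges to the return mapping on the open disc of
radius `R`: to the complexified one and, if the parameters are real, on the positive radii to the
first return mapping of the flow. -/
structure IsReturnSeries (lam : Fin d → ℂ) (R : ℝ) (a : ℕ → ℂ) : Prop where
  isReturn : ∀ z : ℂ, ‖z‖ < R → ∃ w : ℂ, HasSum (fun k => a k * z ^ k) w ∧ IsReturn lam z w
  isFirstReturn : ∀ mu : Fin d → ℝ, (∀ i, lam i = (mu i : ℂ)) → ∀ r : ℝ, 0 < r → r < R →
    ∃ s : ℝ, HasSum (fun k => a k * (r : ℂ) ^ k) (s : ℂ) ∧ IsFirstReturn mu r s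

theorem exists_isReturnSeries (h : IsScale lam ρ) : ∃ a, IsReturnSeries lam (ρ / 2) a := by
  obtain ⟨a, ha⟩ := exists_hasSum_polarSlope_initial_value h
  refine ⟨a, fun z hz => ?_, fun mu hmu x hx hxρ => ?_⟩
  · obtain ⟨r, hr, hrz, hsum⟩ := ha z hz
    exact ⟨r 0, hsum, hrz ▸ isReturn_of_isConfinedIntegralCurve h hr⟩
  · obtain rfl : lam = fun i => (mu i : ℂ) := funext hmu
    obtain ⟨r, hr, hrx, hsum⟩ := ha x (by rwa [Complex.norm_of_nonneg hx.le])
    exact ⟨(r 0).re, (hr.ofReal_re h hrx (left_mem_Icc.2 Real.two_pi_pos.le)).symm ▸ hsum,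
      hr.isFirstReturn h hrx hx⟩

end ReturnSeries

section Inverse

variable {d : ℕ}

theorem IsScale.neg {lam : Fin d → ℂ} {ρ : ℝ} (h : IsScale lam ρ) : IsScale (-lam) ρ :=
  ⟨h.1, by simpa only [Pi.neg_apply, norm_neg] using h.2⟩

theorem lienardPoly_neg {K : Type*} [CommRing K] (lam : Fin d → K) (x : K) :
    lienardPoly (-lam) x = -lienardPoly lam x := by
  simp only [lienardPoly, Pi.neg_apply, neg_mul, Finset.sum_neg_distrib]

theorem polarAngular_neg_two_pi_sub (lam : Fin d → ℂ) (θ : ℝ) (x : ℂ) :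
    polarAngular (-lam) (2 * Real.pi - θ) x = polarAngular lam θ x := by
  rw [polarAngular, polarAngular, lienardPoly_neg, Real.sin_two_pi_sub, Real.cos_two_pi_sub]
  push_cast
  ring

theorem polarSlope_neg_two_pi_sub (lam : Fin d → ℂ) (θ : ℝ) (x : ℂ) :
    polarSlope (-lam) (2 * Real.pi - θ) x = -polarSlope lam θ x := by
  rw [polarSlope, polarSlope, polarAngular_neg_two_pi_sub, lienardPoly_neg, Real.sin_two_pi_sub,
    Real.cos_two_pi_sub]
  push_cast
  ring

theorem mapsTo_const_sub_Icc_zero (T : ℝ) : MapsTo (T - ·) (Icc 0 T) (Icc 0 T) :=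
  fun _ ht => ⟨sub_nonneg.2 ht.2, sub_le_self T ht.1⟩

theorem hasDerivWithinAt_comp_const_sub {E : Type*} [NormedAddCommGroup E] [NormedSpace ℝ E]
    {f : ℝ → E} {f' : E} {T t : ℝ} (hf : HasDerivWithinAt f f' (Icc 0 T) (T - t)) :
    HasDerivWithinAt (fun s => f (T - s)) (-f') (Icc 0 T) t :=
  (hf.scomp t ((hasDerivAt_id t).const_sub T).hasDerivWithinAt
    (mapsTo_const_sub_Icc_zero T)).congr_deriv (neg_one_smul ℝ f')

theorem IsReturn.symm_of_neg {lam : Fin d → ℂ} {z w : ℂ} (h : IsReturn (-lam) z w) :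
    IsReturn lam w z := by
  obtain ⟨r, hz, hw, hr⟩ := h
  refine ⟨fun θ => r (2 * Real.pi - θ), by simp only [sub_self, hw],
    by simp only [sub_zero, hz], fun θ hθ => ?_⟩
  obtain ⟨hne, hderiv⟩ := hr _ (mapsTo_const_sub_Icc_zero _ hθ)
  rw [polarAngular_neg_two_pi_sub] at hne
  rw [polarSlope_neg_two_pi_sub] at hderiv
  exact ⟨hne, by simpa only [neg_neg] using hasDerivWithinAt_comp_const_sub hderiv⟩

theorem IsFirstReturn.symm_of_neg {mu : Fin d → ℝ} {r s : ℝ} (h : IsFirstReturn (-mu) r s) :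
    IsFirstReturn mu s r := by
  obtain ⟨hr, hs, T, hT, γ, hγ, h0, h1, hfirst⟩ := h
  refine ⟨hs, hr, T, hT, fun t => ((γ (T - t)).1, -(γ (T - t)).2), fun t ht => ?_, ?_, ?_,
    fun t ht haxis => ?_⟩
  · have hderiv := hasDerivWithinAt_comp_const_sub (hγ _ (mapsTo_const_sub_Icc_zero T ht))
    have hfst := (ContinuousLinearMap.fst ℝ ℝ ℝ).hasFDerivAt.comp_hasDerivWithinAt t hderiv
    have hsnd := (ContinuousLinearMap.snd ℝ ℝ ℝ).hasFDerivAt.comp_hasDerivWithinAt t hderiv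
    refine (hfst.prodMk hsnd.neg).congr_deriv ?_
    simp [lienardField, lienardPoly_neg]
  · simp only [sub_zero, h1, neg_zero]
  · simp only [sub_self, h0, neg_zero]
  · exact hfirst (T - t) ⟨sub_pos.2 ht.2, sub_lt_self T ht.1⟩ ⟨haxis.1, neg_eq_zero.1 haxis.2⟩

end Inverse

theorem mainTheorem5 (d : ℕ) (hd : 1 ≤ d) :
    -- existence and uniqueness of `ρ`, and convergence on the disc of radius `ρ / 2`
    (∀ lam : Fin d → ℂ, lam ≠ 0 →
      (∃! ρ : ℝ, IsScale lam ρ) ∧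
      ∀ ρ : ℝ, IsScale lam ρ →
        -- `a`: the series of the return mapping; `b`: the series of its inverse
        ∃ a b : ℕ → ℂ,
          (∀ z : ℂ, ‖z‖ < ρ / 2 →
            ∃ w : ℂ, HasSum (fun k : ℕ => a k * z ^ k) w ∧ IsReturn lam z w) ∧
          (∀ z : ℂ, ‖z‖ < ρ / 2 →
            ∃ w : ℂ, HasSum (fun k : ℕ => b k * z ^ k) w ∧ IsReturn lam w z) ∧
          -- for real parameters these are the first return mapping of the flow, and its inverse
          (∀ mu : Fin d → ℝ, (∀ i, lam i = (mu i : ℂ)) →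
            ∀ r : ℝ, 0 < r → r < ρ / 2 →
              (∃ s : ℝ, HasSum (fun k : ℕ => a k * (r : ℂ) ^ k) (s : ℂ) ∧
                IsFirstReturn mu r s) ∧
              (∃ s : ℝ, HasSum (fun k : ℕ => b k * (r : ℂ) ^ k) (s : ℂ) ∧
                IsFirstReturn mu s r))) ∧
    -- `ρ / 2` improves `1 / (1 + |λ|)` for small `|λ|`
    (∃ ε : ℝ, 0 < ε ∧ ∀ lam : Fin d → ℂ, lam ≠ 0 → ∑ i, ‖lam i‖ < ε →
      ∀ ρ : ℝ, IsScale lam ρ → 1 / (1 + ∑ i, ‖lam i‖) < ρ / 2) ∧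
    -- but not, in general, for large `|λ|`
    (∀ M : ℝ, ∃ mu : Fin d → ℝ, M < ∑ i, |mu i| ∧
      ∃ ρ : ℝ, IsScale (fun i => (mu i : ℂ)) ρ ∧ ρ / 2 < 1 / (1 + ∑ i, |mu i|)) := by
  refine ⟨fun lam hlam => ⟨existsUnique_isScale hlam, fun ρ h => ?_⟩,
    ⟨(1 / 2) ^ d, by positivity, fun lam _ hsmall ρ h => h.one_div_one_add_lt hsmall⟩,
    exists_isScale_lt_one_div hd⟩
  obtain ⟨a, ha⟩ := exists_isReturnSeries h
  obtain ⟨b, hb⟩ := exists_isReturnSeries h.neg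
  refine ⟨a, b, ha.isReturn, fun z hz => ?_, fun mu hmu r hr hrρ =>
    ⟨ha.isFirstReturn mu hmu r hr hrρ, ?_⟩⟩
  · obtain ⟨w, hsum, hreturn⟩ := hb.isReturn z hz
    exact ⟨w, hsum, hreturn.symm_of_neg⟩
  · obtain ⟨s, hsum, hreturn⟩ := hb.isFirstReturn (-mu)
      (fun i => by rw [Pi.neg_apply, Pi.neg_apply, hmu, Complex.ofReal_neg]) r hr hrρ
    exact ⟨s, hsum, hreturn.symm_of_neg⟩
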